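/- **Theorem (Oracle estimation rate).** *Setting.* Let $n\ge 1$, let $X\in\mathbb R^{n\times p}$ be a fixed matrix with columns $\|X_j\|_2=n^{1/2}$, and consider $y=X\beta^*+\xi$, where $\xi_1,\dots,\xi_n$ are i.i.d., centered and sub-Gaussian with scale parameter $\sigma^2>0$, i.e. $\mathbf E e^{u\xi_i}\le e^{\sigma^2u^2/2}$ for all $u\in\mathbb R$. For $s^*\ge1$ and $\lambda\in\mathbb R$ let $$\Omega^p_{s^*,\lambda}=\{\beta\in\mathbb R^p:\ \|\beta\|_0=s^*,\ |\beta_i|\ge\lambda\text{ whenever }\beta_i\ne0\}.$$ $X$ satisfies $\mathrm{RIP}(k,\delta)$, $0<\delta<1$, if $(1-\delta)n\|u\|_2^2\le\|Xu\|_2^2\le(1+\delta)n\|u\|_2^2$ for all $u\in\mathbb R^p$ with $\|u\|_0\le k$. Hard thresholding pursuit (HTP) with model size $s$, started at $\beta^0$, iterates: $S^{t+1}$ is the support of the vector obtained from $\beta^t+X^\top(y-X\beta^t)/n$ by setting to zero all but the $s$ entries largest in absolute value (ties broken arbitrarily), and $\beta^{t+1}$ minimizes $\|y-X\beta\|_2$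 over all $\beta$ supported on $S^{t+1}$. For $C_1>0$ call $\beta^0$ (which may be random) *minimax optimal for $\beta^*$* if $$\|\beta^0-\beta^*\|_2\le C_1\sigma\{s^*\log(p/s^*)/n\}^{1/2}\quad\text{and}\quad\|\beta^0\|_0\le s,$$ and let $E_{\beta^*}$ be the event that this holds. *Claim.* For every $0<\epsilon<1$ there are positive constants $C_{2,\epsilon},C_{3,\epsilon},C_{4,\epsilon}$ depending only on $\epsilon$, and for every $C_1>0$ there is a positive constant $C_{1,\epsilon}$ depending only on $\epsilon$ and $C_1$, such that the following holds whenever $X$ satisfies $\mathrm{RIP}(3s,\delta_{3s})$ with $\delta_{3s}<\epsilon^2\wedge0.005$ and $\lambda\ge(1+3\epsilon)\sigma\{2\log(p/s^*)/n\}^{1/2}$. (i) If $s\in[s^*,\,s^*+s^*/\log(p/s^*)]$, then for every integer $t\ge0$ with $t\ge\log\{C_{1,\epsilon}^2\log(p/s^*)\}$, $$\sup_{\beta^*\in\Omega^p_{s^*,\lambda}}\mathrm{pr}\Big(E_{\beta^*}\cap\Big\{\|\beta^t-\beta^*\|_2\ge C_{2,\epsilon}\,\sigma\Big(\frac{s^*}{n}\Big)^{1/2}\Big\}\Big)\le\exp(-C_{3,\epsilon}s^*)+\Big(\frac{s^*}{p}\Big)^{C_{4,\epsilon}}.$$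 (ii) If $s=s^*+\tau$ with an integer $\tau\in(s^*/\log(p/s^*),\,3s^*]$, then for every integer $t\ge0$ with $t\ge\log(C_1^2s^*/\tau)$, $$\sup_{\beta^*\in\Omega^p_{s^*,\lambda}}\mathrm{pr}\Big(E_{\beta^*}\cap\Big\{\|\beta^t-\beta^*\|_2\ge C_{2,\epsilon}\,\sigma\Big(\frac{\tau\log(p/s^*)}{n}\Big)^{1/2}\Big\}\Big)\le\exp(-C_{3,\epsilon}s^*)+\Big(\frac{s^*}{p}\Big)^{C_{4,\epsilon}}.$$ In particular, if $\beta^0$ is almost surely minimax optimal for $\beta^*$, for every $\beta^*\in\Omega^p_{s^*,\lambda}$, then $E_{\beta^*}$ can be omitted from both displays. -/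

import Mathlib

open MeasureTheory ProbabilityTheory

noncomputable section

namespace HTP

/-- The number `‖β‖₀` of nonzero entries of `β`. -/
def l0 {p : ℕ} (β : EuclideanSpace ℝ (Fin p)) : ℕ :=
  (Finset.univ.filter fun i => β i ≠ 0).card

/-- `β` vanishes outside `S`. -/
def SupportedOn {p : ℕ} (S : Finset (Fin p)) (β : EuclideanSpace ℝ (Fin p)) : Prop :=
  ∀ i, i ∉ S → β i = 0

/-- Restricted isometry property of order `k` with constant `δ`. A vector `u ∈ ℝ^S` is identified
with its extension by zero to `ℝ^p`. -/
def RIP {n p : ℕ} (X : Matrix (Fin n) (Fin p) ℝ) (k : ℕ) (δ : ℝ) : Prop :=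
  0 < δ ∧ δ < 1 ∧
    ∀ S : Finset (Fin p), S.card ≤ k → ∀ u : EuclideanSpace ℝ (Fin p), SupportedOn S u → u ≠ 0 →
      1 - δ ≤ ‖X.toEuclideanLin u‖ ^ 2 / (n * ‖u‖ ^ 2) ∧
        ‖X.toEuclideanLin u‖ ^ 2 / (n * ‖u‖ ^ 2) ≤ 1 + δ

/-- `v` is obtained from `u` by setting to zero all but `s` entries that are largest in absolute
value (all entries are kept if `s ≥ p`); any way of breaking ties is admitted. -/
def IsHardThreshold {p : ℕ} (s : ℕ) (u v : EuclideanSpace ℝ (Fin p)) : Prop :=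
  ∃ S : Finset (Fin p), S.card = min s p ∧ (∀ i ∈ S, ∀ j, j ∉ S → |u j| ≤ |u i|) ∧
    ∀ i, v i = if i ∈ S then u i else 0

/-- `b` minimizes `‖y - X c‖₂` among all vectors `c` supported on `S`. -/
def IsLeastSquaresOn {n p : ℕ} (X : Matrix (Fin n) (Fin p) ℝ) (y : EuclideanSpace ℝ (Fin n))
    (S : Finset (Fin p)) (b : EuclideanSpace ℝ (Fin p)) : Prop :=
  SupportedOn S b ∧ ∀ c : EuclideanSpace ℝ (Fin p), SupportedOn S c →
    ‖y - X.toEuclideanLin b‖ ≤ ‖y - X.toEuclideanLin c‖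

/-- One iteration of hard thresholding pursuit, from `b` to `b'`. -/
def IsStep {n p : ℕ} (X : Matrix (Fin n) (Fin p) ℝ) (y : EuclideanSpace ℝ (Fin n)) (s : ℕ)
    (b b' : EuclideanSpace ℝ (Fin p)) : Prop :=
  ∃ v : EuclideanSpace ℝ (Fin p),
    IsHardThreshold s
      (b + (1 / (n : ℝ)) • X.transpose.toEuclideanLin (y - X.toEuclideanLin b)) v ∧
    IsLeastSquaresOn X y (Finset.univ.filter fun i => v i ≠ 0) b'

/-- `b 0, b 1, b 2, …` are the iterates of hard thresholding pursuit with data `X, y` and model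
size `s`, started at `b 0`. -/
def IsRun {n p : ℕ} (X : Matrix (Fin n) (Fin p) ℝ) (y : EuclideanSpace ℝ (Fin n)) (s : ℕ)
    (b : ℕ → EuclideanSpace ℝ (Fin p)) : Prop :=
  ∀ t, IsStep X y s (b t) (b (t + 1))

/-- The `s⋆`-sparse vectors in `ℝ^p` whose nonzero entries have absolute value at least `lam`. -/
def signalClass (p sstar : ℕ) (lam : ℝ) : Set (EuclideanSpace ℝ (Fin p)) :=
  {β | l0 β = sstar ∧ ∀ i, β i ≠ 0 → lam ≤ |β i|}

/-- `ξ₁, …, ξₙ` are i.i.d., centered and sub-Gaussian with scale parameter `σ²`, that is,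
`E exp (u ξᵢ) ≤ exp (σ² u² / 2)` for all real `u`. -/
structure IsSubGaussianNoise {Ω : Type*} [MeasurableSpace Ω] (P : Measure Ω) {n : ℕ}
    (ξ : Fin n → Ω → ℝ) (σ : ℝ) : Prop where
  measurable : ∀ i, Measurable (ξ i)
  indep : iIndepFun ξ P
  identDistrib : ∀ i j, IdentDistrib (ξ i) (ξ j) P P
  mean_zero : ∀ i, ∫ ω, ξ i ω ∂P = 0
  subGaussian : ∀ i, HasSubgaussianMGF (ξ i) (Real.toNNReal (σ ^ 2)) P

/-- The response `y = X β + ξ` of the linear model at the sample point `ω`. -/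
def response {Ω : Type*} {n p : ℕ} (X : Matrix (Fin n) (Fin p) ℝ) (ξ : Fin n → Ω → ℝ)
    (β : EuclideanSpace ℝ (Fin p)) (ω : Ω) : EuclideanSpace ℝ (Fin n) :=
  X.toEuclideanLin β + WithLp.toLp 2 (fun i => ξ i ω)

/-- The initial value `b₀` attains the minimax rate for estimating `β` with constant `C₁`, and has
at most `s` nonzero entries. -/
def IsMinimaxInit {p : ℕ} (C₁ σ : ℝ) (n sstar s : ℕ) (β b₀ : EuclideanSpace ℝ (Fin p)) : Prop :=
  ‖b₀ - β‖ ≤ C₁ * σ * √(sstar * Real.log (p / sstar) / n) ∧ l0 b₀ ≤ s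

end HTP

end

noncomputable section

namespace HTP

/-! The proof separates a deterministic contraction from two noise events that do not involve the
iterates.

Write `z = Xᵀξ/n`, `S` for the support of `β`, and `a = σ(2 log(p/s*)/n)^{1/2}`. The vector that is
thresholded equals `β + (I - XᵀX/n)(b - β) + z`. By RIP the middle term has norm at most `δ‖b - β‖`
on any relevant set of coordinates, so only thresholding errors matter. The selected support `T`
errs by missing entries of `β` and by admitting pure noise. A missed entry has size at least `(1 +
3ε)a`. A falsely selected noise entry either exceeds `(1 + ε)a` or is at most that level. The gap
between the two levels forces each remaining error to be paid for by a perturbation, by a matching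
missed entry or by the `s - s*` surplus slots (`missed_add_false_le`). Least squares on `T` then
turns this into `‖b' - β‖ ≤ ‖b - β‖/2 + noise` (`IsStep.error_le`), which is iterated.

The noise consists of `‖z_S‖`, of the part of `z` outside `S` above `(1 + ε)a`, and of `a(s -
s*)^{1/2}`. The first has an exponential tail, by averaging over an independent Gaussian direction.
The second is controlled in mean square, and Markov's inequality gives the probability `(s*/p)^ε`.
Both events depend only on `β`, `X` and `ξ`, so one exceptional set serves every `t` and any random
start, with no measurability required of the iterates. -/

/-- The Euclidean norm of the restriction of `f` to `V`. -/
def partialNorm {ι : Type*} (V : Finset ι) (f : ι → ℝ) : ℝ := √(∑ i ∈ V, f i ^ 2)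

/-! ### Norms restricted to a set of coordinates -/

section PartialNorm

variable {ι : Type*} {V V' : Finset ι} {f g k : ι → ℝ}

lemma partialNorm_nonneg (V : Finset ι) (f : ι → ℝ) : 0 ≤ partialNorm V f := Real.sqrt_nonneg _

lemma partialNorm_sq (V : Finset ι) (f : ι → ℝ) : partialNorm V f ^ 2 = ∑ i ∈ V, f i ^ 2 :=
  Real.sq_sqrt (Finset.sum_nonneg fun _ _ => sq_nonneg _)

lemma partialNorm_le_add (h : ∀ i ∈ V, |f i| ≤ |g i| + |k i|) :
    partialNorm V f ≤ partialNorm V g + partialNorm V k := by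
  have hg := partialNorm_nonneg V g
  have hk := partialNorm_nonneg V k
  refine Real.sqrt_le_iff.2 ⟨add_nonneg hg hk, ?_⟩
  have hcs : ∑ i ∈ V, |g i| * |k i| ≤ partialNorm V g * partialNorm V k := by
    simpa [partialNorm] using
      Real.sum_mul_le_sqrt_mul_sqrt V (fun i => |g i|) (fun i => |k i|)
  calc ∑ i ∈ V, f i ^ 2 ≤ ∑ i ∈ V, (|g i| + |k i|) ^ 2 := by
        refine Finset.sum_le_sum fun i hi => ?_
        rw [← sq_abs (f i)]
        exact pow_le_pow_left₀ (abs_nonneg _) (h i hi) 2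
    _ = ∑ i ∈ V, g i ^ 2 + 2 * ∑ i ∈ V, |g i| * |k i| + ∑ i ∈ V, k i ^ 2 := by
        rw [Finset.mul_sum, ← Finset.sum_add_distrib, ← Finset.sum_add_distrib]
        refine Finset.sum_congr rfl fun i _ => ?_
        rw [← sq_abs (g i), ← sq_abs (k i)]
        ring
    _ ≤ (partialNorm V g + partialNorm V k) ^ 2 := by
        rw [← partialNorm_sq, ← partialNorm_sq]
        nlinarith

lemma partialNorm_mono (hV : V ⊆ V') : partialNorm V f ≤ partialNorm V' f :=
  Real.sqrt_le_sqrt (Finset.sum_le_sum_of_subset_of_nonneg hV fun _ _ _ => sq_nonneg _)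

lemma partialNorm_le_of_abs_le (h : ∀ i ∈ V, |f i| ≤ |g i|) :
    partialNorm V f ≤ partialNorm V g :=
  Real.sqrt_le_sqrt (Finset.sum_le_sum fun i hi => sq_le_sq.2 (h i hi))

lemma partialNorm_const_mul {c : ℝ} (hc : 0 ≤ c) :
    partialNorm V (fun i => c * f i) = c * partialNorm V f := by
  simp only [partialNorm, mul_pow, ← Finset.mul_sum]
  rw [Real.sqrt_mul (sq_nonneg c), Real.sqrt_sq hc]

lemma partialNorm_const {c : ℝ} (hc : 0 ≤ c) :
    partialNorm V (fun _ => c) = c * √(V.card : ℝ) := by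
  simp only [partialNorm, Finset.sum_const, nsmul_eq_mul]
  rw [mul_comm, Real.sqrt_mul (sq_nonneg c), Real.sqrt_sq hc]

lemma partialNorm_inter_add_sdiff [DecidableEq ι] (V S : Finset ι) (f : ι → ℝ) :
    partialNorm V f ≤ partialNorm (V ∩ S) f + partialNorm (V \ S) f := by
  refine Real.sqrt_le_iff.2 ⟨add_nonneg (partialNorm_nonneg _ _) (partialNorm_nonneg _ _), ?_⟩
  have h := Finset.sum_inter_add_sum_sdiff V S (fun i => f i ^ 2)
  rw [← h, ← partialNorm_sq, ← partialNorm_sq]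
  nlinarith [partialNorm_nonneg (V ∩ S) f, partialNorm_nonneg (V \ S) f]

lemma partialNorm_univ {p : ℕ} (x : EuclideanSpace ℝ (Fin p)) :
    partialNorm Finset.univ (fun i => x i) = ‖x‖ := by
  simp [partialNorm, EuclideanSpace.norm_eq]

lemma sum_le_sum_of_card_le {A B : Finset ι} (hcard : A.card ≤ B.card)
    (hf : ∀ i, 0 ≤ f i) (h : ∀ a ∈ A, ∀ b ∈ B, f a ≤ f b) : ∑ a ∈ A, f a ≤ ∑ b ∈ B, f b := by
  rcases A.eq_empty_or_nonempty with rfl | hA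
  · simpa using Finset.sum_nonneg fun i _ => hf i
  obtain ⟨m, hm, hmax⟩ := A.exists_max_image f hA
  calc ∑ a ∈ A, f a ≤ A.card • f m := Finset.sum_le_card_nsmul _ _ _ hmax
    _ ≤ B.card • f m := nsmul_le_nsmul_left (hf m) hcard
    _ ≤ ∑ b ∈ B, f b := Finset.card_nsmul_le_sum _ _ _ (h m hm)

end PartialNorm

/-! ### Consequences of RIP, least squares and thresholding -/

section Design

variable {n p : ℕ} {X : Matrix (Fin n) (Fin p) ℝ}

lemma inner_toEuclideanLin (X : Matrix (Fin n) (Fin p) ℝ) (u : EuclideanSpace ℝ (Fin p))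
    (v : EuclideanSpace ℝ (Fin n)) :
    inner ℝ (X.toEuclideanLin u) v = inner ℝ u (X.transpose.toEuclideanLin v) := by
  rw [← Matrix.conjTranspose_eq_transpose_of_trivial, Matrix.toEuclideanLin_conjTranspose_eq_adjoint,
    LinearMap.adjoint_inner_right]

lemma SupportedOn.mono {S S' : Finset (Fin p)} {u : EuclideanSpace ℝ (Fin p)}
    (hu : SupportedOn S u) (h : S ⊆ S') : SupportedOn S' u := fun i hi => hu i fun hS => hi (h hS)

lemma SupportedOn.add {S : Finset (Fin p)} {u v : EuclideanSpace ℝ (Fin p)}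
    (hu : SupportedOn S u) (hv : SupportedOn S v) : SupportedOn S (u + v) := fun i hi => by
  simp [hu i hi, hv i hi]

lemma SupportedOn.smul {S : Finset (Fin p)} {u : EuclideanSpace ℝ (Fin p)}
    (hu : SupportedOn S u) (c : ℝ) : SupportedOn S (c • u) := fun i hi => by
  simp [hu i hi]

lemma SupportedOn.sub {S : Finset (Fin p)} {u v : EuclideanSpace ℝ (Fin p)}
    (hu : SupportedOn S u) (hv : SupportedOn S v) : SupportedOn S (u - v) := fun i hi => by
  simp [hu i hi, hv i hi]

/-- The support of a vector. -/
def supp (u : EuclideanSpace ℝ (Fin p)) : Finset (Fin p) := Finset.univ.filter fun i => u i ≠ 0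

lemma supportedOn_supp (u : EuclideanSpace ℝ (Fin p)) : SupportedOn (supp u) u := fun i hi => by
  simpa [supp] using hi

lemma SupportedOn.supp_subset {S : Finset (Fin p)} {u : EuclideanSpace ℝ (Fin p)}
    (hu : SupportedOn S u) : supp u ⊆ S := fun i hi => by
  by_contra h
  exact (by simpa [supp] using hi : u i ≠ 0) (hu i h)

/-- The vector `(I - XᵀX / n) h`. -/
def gramDefect (X : Matrix (Fin n) (Fin p) ℝ) (h : EuclideanSpace ℝ (Fin p)) :
    EuclideanSpace ℝ (Fin p) :=
  h - (1 / (n : ℝ)) • X.transpose.toEuclideanLin (X.toEuclideanLin h)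

lemma inner_gramDefect (w h : EuclideanSpace ℝ (Fin p)) :
    inner ℝ w (gramDefect X h) =
      inner ℝ w h - 1 / (n : ℝ) * inner ℝ (X.toEuclideanLin w) (X.toEuclideanLin h) := by
  rw [gramDefect, inner_sub_right, inner_smul_right, ← inner_toEuclideanLin]

lemma RIP.norm_sq_bounds {k : ℕ} {δ : ℝ} (hR : RIP X k δ) (hn : 0 < n) {S : Finset (Fin p)}
    (hS : S.card ≤ k) {u : EuclideanSpace ℝ (Fin p)} (hu : SupportedOn S u) :
    (1 - δ) * ‖u‖ ^ 2 ≤ 1 / (n : ℝ) * ‖X.toEuclideanLin u‖ ^ 2 ∧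
      1 / (n : ℝ) * ‖X.toEuclideanLin u‖ ^ 2 ≤ (1 + δ) * ‖u‖ ^ 2 := by
  rcases eq_or_ne u 0 with rfl | h0
  · simp
  have hn' : (0 : ℝ) < n := by exact_mod_cast hn
  have hu2 : 0 < ‖u‖ ^ 2 := by positivity
  obtain ⟨h1, h2⟩ := hR.2.2 S hS u hu h0
  have e : 1 / (n : ℝ) * ‖X.toEuclideanLin u‖ ^ 2 =
      ‖X.toEuclideanLin u‖ ^ 2 / (n * ‖u‖ ^ 2) * ‖u‖ ^ 2 := by field_simp
  rw [e]
  exact ⟨mul_le_mul_of_nonneg_right h1 hu2.le, mul_le_mul_of_nonneg_right h2 hu2.le⟩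

/-- Polarization: the lower RIP bound at `x + y` and the upper one at `x - y` control the cross term
by `δ(‖x‖² + ‖y‖²)/2`. Rescaling the two vectors to equal norms turns this sum into a product. -/
lemma RIP.inner_gramDefect_le {k : ℕ} {δ : ℝ} (hR : RIP X k δ) (hn : 0 < n)
    {S : Finset (Fin p)} (hS : S.card ≤ k) {w h : EuclideanSpace ℝ (Fin p)}
    (hw : SupportedOn S w) (hh : SupportedOn S h) :
    inner ℝ w (gramDefect X h) ≤ δ * ‖w‖ * ‖h‖ := by
  have key : ∀ x y : EuclideanSpace ℝ (Fin p), SupportedOn S x → SupportedOn S y →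
      2 * inner ℝ x (gramDefect X y) ≤ δ * (‖x‖ ^ 2 + ‖y‖ ^ 2) := by
    intro x y hx hy
    have h1 := (hR.norm_sq_bounds hn hS (hx.add hy)).1
    have h2 := (hR.norm_sq_bounds hn hS (hx.sub hy)).2
    rw [map_add, norm_add_sq_real, norm_add_sq_real] at h1
    rw [map_sub, norm_sub_sq_real, norm_sub_sq_real] at h2
    rw [inner_gramDefect]
    linarith
  rcases eq_or_ne w 0 with rfl | hw0
  · simp
  rcases eq_or_ne h 0 with rfl | hh0
  · simp [gramDefect]
  have hwp : 0 < ‖w‖ := norm_pos_iff.2 hw0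
  have hhp : 0 < ‖h‖ := norm_pos_iff.2 hh0
  have := key (‖h‖ • w) (‖w‖ • h) (hw.smul _) (hh.smul _)
  rw [inner_gramDefect, map_smul, map_smul, norm_smul, norm_smul, norm_norm, norm_norm,
    real_inner_smul_left, real_inner_smul_right, real_inner_smul_left, real_inner_smul_right] at this
  rw [inner_gramDefect]
  refine le_of_mul_le_mul_left ?_ (mul_pos hwp hhp)
  linarith

/-- Duality: the bilinear bound is tested against the restriction of the defect to `V`. -/
lemma RIP.partialNorm_gramDefect_le {k : ℕ} {δ : ℝ} (hR : RIP X k δ) (hn : 0 < n)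
    {S V : Finset (Fin p)} (hS : S.card ≤ k) (hV : V ⊆ S) {h : EuclideanSpace ℝ (Fin p)}
    (hh : SupportedOn S h) : partialNorm V (fun i => gramDefect X h i) ≤ δ * ‖h‖ := by
  set N := partialNorm V (fun i => gramDefect X h i) with hN
  set w : EuclideanSpace ℝ (Fin p) :=
    WithLp.toLp 2 (fun i => if i ∈ V then gramDefect X h i else 0) with hwdef
  have hw : SupportedOn S w := fun i hi => by
    simp [w, show i ∉ V from fun hiV => hi (hV hiV)]
  have h1 : inner ℝ w (gramDefect X h) = N ^ 2 := by
    rw [hN, partialNorm_sq, PiLp.inner_apply]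
    simp [w, Finset.sum_ite_mem, sq]
  have h2 : ‖w‖ = N := by
    rw [← partialNorm_univ, hN, partialNorm, partialNorm]
    congr 1
    simp [w, ite_pow, Finset.sum_ite_mem]
  have h3 := hR.inner_gramDefect_le hn hS hw hh
  rw [h1, h2] at h3
  have hN0 : 0 ≤ N := partialNorm_nonneg _ _
  rcases hN0.eq_or_lt with h0 | h0
  · rw [← h0]; exact mul_nonneg hR.1.le (norm_nonneg _)
  · refine le_of_mul_le_mul_left ?_ h0
    linarith

/-- The residual of a least squares fit is orthogonal to the selected columns. -/
lemma IsLeastSquaresOn.transpose_residual_eq_zero {y : EuclideanSpace ℝ (Fin n)}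
    {S : Finset (Fin p)} {b : EuclideanSpace ℝ (Fin p)} (hb : IsLeastSquaresOn X y S b)
    {i : Fin p} (hi : i ∈ S) : X.transpose.toEuclideanLin (y - X.toEuclideanLin b) i = 0 := by
  set r := y - X.toEuclideanLin b with hr
  set e : EuclideanSpace ℝ (Fin p) := EuclideanSpace.single i 1 with he
  have hin : X.transpose.toEuclideanLin r i = inner ℝ (X.toEuclideanLin e) r := by
    rw [inner_toEuclideanLin, he, EuclideanSpace.inner_single_left]
    simp
  have hes : SupportedOn S e := fun j hj => by
    have : j ≠ i := fun h => hj (h ▸ hi)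
    simp [e, this]
  rw [hin, real_inner_comm]
  set v := X.toEuclideanLin e
  set c := inner ℝ r v
  have key : ∀ t : ℝ, 0 ≤ t ^ 2 * ‖v‖ ^ 2 - 2 * t * c := by
    intro t
    have h := hb.2 (b + t • e) (hb.1.add (hes.smul t))
    have e1 : y - X.toEuclideanLin (b + t • e) = r - t • v := by
      rw [map_add, map_smul, hr]; abel
    rw [e1, ← hr] at h
    have h' := pow_le_pow_left₀ (norm_nonneg _) h 2
    rw [norm_sub_sq_real r, inner_smul_right, norm_smul, mul_pow, Real.norm_eq_abs, sq_abs] at h'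
    linarith
  by_contra hc
  have hv : 0 < ‖v‖ ^ 2 + 1 := by positivity
  -- The minimizer of the quadratic would be `c / ‖v‖²`; adding 1 to the denominator avoids a case
  -- split on `v = 0` and still gives a negative value.
  have := key (c / (‖v‖ ^ 2 + 1))
  have e2 : (c / (‖v‖ ^ 2 + 1)) ^ 2 * ‖v‖ ^ 2 - 2 * (c / (‖v‖ ^ 2 + 1)) * c =
      - (c ^ 2 * (‖v‖ ^ 2 + 2) / (‖v‖ ^ 2 + 1) ^ 2) := by
    field_simp; ring
  rw [e2] at this
  have : 0 < c ^ 2 * (‖v‖ ^ 2 + 2) / (‖v‖ ^ 2 + 1) ^ 2 := by positivity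
  linarith

/-- The support of `v` may be smaller than the kept set, since kept entries of `u` can vanish. In
that case the ordering makes `u` zero everywhere off the support, which is the second alternative.
-/
lemma IsHardThreshold.supp_properties {s : ℕ} {u v : EuclideanSpace ℝ (Fin p)}
    (h : IsHardThreshold s u v) :
    (supp v).card ≤ s ∧ (∀ j ∈ supp v, ∀ i, i ∉ supp v → |u i| ≤ |u j|) ∧
      ((supp v).card = min s p ∨ ∀ i, i ∉ supp v → u i = 0) := by
  obtain ⟨S, hS, hord, hv⟩ := h
  have hmem : ∀ i, i ∈ supp v ↔ i ∈ S ∧ u i ≠ 0 := fun i => by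
    simp [supp, hv i]
  have hsub : supp v ⊆ S := fun i hi => ((hmem i).1 hi).1
  refine ⟨(Finset.card_le_card hsub).trans (hS ▸ min_le_left _ _), fun j hj i hi => ?_, ?_⟩
  · by_cases hiS : i ∈ S
    · have : u i = 0 := by
        by_contra h0
        exact hi ((hmem i).2 ⟨hiS, h0⟩)
      simp [this]
    · exact hord j (hsub hj) i hiS
  · by_cases hST : S ⊆ supp v
    · left
      rw [← hS, hsub.antisymm hST]
    · right
      obtain ⟨k, hkS, hk⟩ := Finset.not_subset.1 hST
      have huk : u k = 0 := by
        by_contra h0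
        exact hk ((hmem k).2 ⟨hkS, h0⟩)
      intro i hi
      by_cases hiS : i ∈ S
      · by_contra h0
        exact hi ((hmem i).2 ⟨hiS, h0⟩)
      · have := hord k hkS i hiS
        rw [huk, abs_zero] at this
        exact abs_nonpos_iff.1 this

end Design

/-! ### Deterministic analysis of support selection -/

/-- The entry `x` if it exceeds the level `c` in absolute value, and `0` otherwise. -/
def trunc (c x : ℝ) : ℝ := if c < |x| then x else 0

lemma abs_le_abs_trunc_add {c x y : ℝ} (h : |x| ≤ c → |x| ≤ |y|) :
    |x| ≤ |trunc c x| + |y| := by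
  unfold trunc
  split_ifs with hx
  · exact le_add_of_nonneg_right (abs_nonneg _)
  · simpa using h (not_lt.1 hx)

/-- Missed entries and falsely selected entries of a support `T` chosen by the size of the entries
of `u = β + φ + z`, in terms of the perturbations `φ` and `z`. -/
lemma missed_add_false_le {ι : Type*} [Fintype ι] [DecidableEq ι] {S T : Finset ι}
    {β φ z u : ι → ℝ} {ε a D : ℝ} {s : ℕ} (hε0 : 0 < ε) (hε1 : ε < 1) (ha : 0 ≤ a)
    (hu : ∀ i, u i = β i + φ i + z i) (hβ0 : ∀ i, i ∉ S → β i = 0)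
    (hβ : ∀ i ∈ S, (1 + 3 * ε) * a ≤ |β i|) (hord : ∀ j ∈ T, ∀ i, i ∉ T → |u i| ≤ |u j|)
    (hTs : T.card ≤ s) (hSs : S.card ≤ s) (hT : S.card ≤ T.card ∨ ∀ i, i ∉ T → u i = 0)
    (hDS : partialNorm S φ ≤ D) (hDT : partialNorm T φ ≤ D) :
    partialNorm (S \ T) β + partialNorm (T \ S) z ≤
      (6 + 2 / ε) * D + (6 + 2 / ε) * partialNorm S z
        + 2 * partialNorm Sᶜ (fun i => trunc ((1 + ε) * a) (z i))
        + 2 * (a * √((s : ℝ) - S.card)) := by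
  set A := partialNorm (S \ T) β
  set F := partialNorm (T \ S) z
  set Z := partialNorm S z
  set W := partialNorm Sᶜ (fun i => trunc ((1 + ε) * a) (z i))
  have hD0 : 0 ≤ D := (partialNorm_nonneg _ _).trans hDS
  have hZ0 : 0 ≤ Z := partialNorm_nonneg _ _
  have hW0 : 0 ≤ W := partialNorm_nonneg _ _
  have hε' : 0 ≤ 1 / ε := by positivity
  have hτ0 : 0 ≤ a * √((s : ℝ) - S.card) := by positivity
  have hWsub : partialNorm (T \ S) (fun i => trunc ((1 + ε) * a) (z i)) ≤ W :=
    partialNorm_mono fun i hi => by simpa using (Finset.mem_sdiff.1 hi).2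
  have hφS : partialNorm (S \ T) φ ≤ D := (partialNorm_mono Finset.sdiff_subset).trans hDS
  have hφT : partialNorm (T \ S) φ ≤ D := (partialNorm_mono Finset.sdiff_subset).trans hDT
  have hzS : partialNorm (S \ T) z ≤ Z := partialNorm_mono Finset.sdiff_subset
  have e6 : 6 + 2 / ε = 2 * (3 + 1 / ε) := by ring
  -- The level `(1 + 2ε)a` lies strictly between signal and noise levels when `a > 0`. Either every
  -- missed entry of `u` is below it, so the misses are due to perturbation, or every selected entry
  -- is above it, so the false selections are.
  by_cases hcase : ∀ i ∈ S \ T, |u i| ≤ (1 + 2 * ε) * a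
  · have hA : A ≤ (3 + 1 / ε) * (D + Z) := by
      have h1 : A ≤ partialNorm (S \ T) (fun i => (3 + 1 / ε) * φ i)
          + partialNorm (S \ T) (fun i => (3 + 1 / ε) * z i) := by
        refine partialNorm_le_add fun i hi => ?_
        have h2 := hcase i hi
        have h3 := hβ i (Finset.mem_sdiff.1 hi).1
        have h4 : |β i| ≤ |u i| + |φ i| + |z i| := by
          have : β i = u i - φ i - z i := by rw [hu i]; ring
          rw [this]
          exact (abs_sub _ _).trans (add_le_add_left (abs_sub _ _) _)
        rw [abs_mul, abs_mul, abs_of_nonneg (by positivity : 0 ≤ 3 + 1 / ε), ← mul_add]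
        -- As `a ≤ |β i| / (1 + 3ε)`, at least the fraction `ε / (1 + 3ε)` of `|β i|` was removed by
        -- `φ` and `z`.
        have h5 : ε * |β i| ≤ (1 + 3 * ε) * (|φ i| + |z i|) := by nlinarith
        have h6 : (3 + 1 / ε) * (|φ i| + |z i|) = (1 + 3 * ε) * (|φ i| + |z i|) / ε := by
          field_simp; ring
        rw [h6, le_div_iff₀ hε0]
        linarith
      rw [partialNorm_const_mul (by positivity), partialNorm_const_mul (by positivity)] at h1
      refine h1.trans ?_
      rw [← mul_add]
      gcongr
    have hF : F ≤ W + 2 * (a * √((s : ℝ) - S.card)) + A := by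
      have h1 : F ≤ partialNorm (T \ S) (fun i => trunc ((1 + ε) * a) (z i))
          + partialNorm (T \ S) (fun _ => (1 + ε) * a) :=
        partialNorm_le_add fun i _ => abs_le_abs_trunc_add fun h => h.trans (le_abs_self _)
      rw [partialNorm_const (by positivity)] at h1
      -- False selections outnumber misses by at most the surplus `s - |S|`. Those matched with
      -- misses cost at most `A`, since each missed entry exceeds `(1 + ε)a`.
      have hcard : ((T \ S).card : ℝ) ≤ ((s : ℝ) - S.card) + (S \ T).card := by
        have h2 := Finset.card_sdiff_add_card_inter T S
        have h3 := Finset.card_sdiff_add_card_inter S T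
        rw [Finset.inter_comm] at h3
        have : (T \ S).card + S.card ≤ s + (S \ T).card := by omega
        have : ((T \ S).card : ℝ) + S.card ≤ s + (S \ T).card := by exact_mod_cast this
        linarith
      have hsS : (0 : ℝ) ≤ (s : ℝ) - S.card := by
        have : (S.card : ℝ) ≤ s := by exact_mod_cast hSs
        linarith
      have h4 : √((T \ S).card : ℝ) ≤ √((s : ℝ) - S.card) + √((S \ T).card : ℝ) :=
        by
        refine (Real.sqrt_le_sqrt hcard).trans (Real.sqrt_le_iff.2 ⟨by positivity, ?_⟩)
        rw [add_sq, Real.sq_sqrt hsS, Real.sq_sqrt (Nat.cast_nonneg _)]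
        have : 0 ≤ √((s : ℝ) - S.card) * √((S \ T).card : ℝ) := by positivity
        linarith
      have h5 : (1 + ε) * a * √((S \ T).card : ℝ) ≤ A := by
        rw [← partialNorm_const (by positivity)]
        refine partialNorm_le_of_abs_le fun i hi => ?_
        rw [abs_of_nonneg (by positivity)]
        refine le_trans ?_ (hβ i (Finset.mem_sdiff.1 hi).1)
        gcongr
        linarith
      have h6 : (1 + ε) * a * √((T \ S).card : ℝ) ≤
          (1 + ε) * a * (√((s : ℝ) - S.card) + √((S \ T).card : ℝ)) := by gcongr
      nlinarith
    rw [e6]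
    linarith
  · push Not at hcase
    obtain ⟨i₀, hi₀, hlt⟩ := hcase
    have hi₀T := (Finset.mem_sdiff.1 hi₀).2
    have hbig : ∀ j ∈ T, (1 + 2 * ε) * a < |u j| := fun j hj => hlt.trans_le (hord j hj i₀ hi₀T)
    -- The missed entry `i₀` is nonzero in `u`, so the selected support is not deficient.
    have hcard : S.card ≤ T.card := by
      refine hT.resolve_right fun h => ?_
      rw [h i₀ hi₀T, abs_zero] at hlt
      have : 0 ≤ (1 + 2 * ε) * a := by positivity
      linarith
    have hF : F ≤ W + (1 + 1 / ε) * D := by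
      have h1 : F ≤ partialNorm (T \ S) (fun i => trunc ((1 + ε) * a) (z i))
          + partialNorm (T \ S) (fun i => (1 + 1 / ε) * φ i) := by
        refine partialNorm_le_add fun i hi => abs_le_abs_trunc_add fun hz => ?_
        obtain ⟨hiT, hiS⟩ := Finset.mem_sdiff.1 hi
        have h2 := hbig i hiT
        rw [hu i, hβ0 i hiS, zero_add] at h2
        have h3 := abs_add_le (φ i) (z i)
        rw [abs_mul, abs_of_nonneg (by positivity : 0 ≤ 1 + 1 / ε)]
        -- A selected noise entry of size at most `(1 + ε)a` needs `φ` to lift it above `(1 + 2ε)a`.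
        have h4 : ε * a ≤ |φ i| := by linarith
        have h5 : (1 + 1 / ε) * |φ i| = (1 + ε) * (|φ i| / ε) := by field_simp; ring
        rw [h5]
        refine hz.trans ?_
        gcongr
        rw [le_div_iff₀ hε0]
        linarith
      rw [partialNorm_const_mul (by positivity)] at h1
      refine h1.trans ?_
      gcongr
    have hA : A ≤ 2 * D + F + Z := by
      have h1 : A ≤ partialNorm (S \ T) (fun i => |u i| + |φ i|) + partialNorm (S \ T) z := by
        refine partialNorm_le_add fun i _ => ?_
        have : β i = u i - φ i - z i := by rw [hu i]; ring
        rw [this, abs_of_nonneg (by positivity : 0 ≤ |u i| + |φ i|)]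
        exact (abs_sub _ _).trans (add_le_add_left (abs_sub _ _) _)
      have h2 : partialNorm (S \ T) (fun i => |u i| + |φ i|)
          ≤ partialNorm (S \ T) u + partialNorm (S \ T) φ :=
        partialNorm_le_add fun i _ => by rw [abs_of_nonneg (by positivity)]
      -- There are at least as many false selections as misses, and each is at least as large in
      -- `u`.
      have h3 : partialNorm (S \ T) u ≤ partialNorm (T \ S) u := by
        refine Real.sqrt_le_sqrt (sum_le_sum_of_card_le ?_ (fun _ => sq_nonneg _) ?_)
        · have h2 := Finset.card_sdiff_add_card_inter T S
          have h3 := Finset.card_sdiff_add_card_inter S T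
          rw [Finset.inter_comm] at h3
          omega
        · intro i hi j hj
          exact sq_le_sq.2 (hord j (Finset.mem_sdiff.1 hj).1 i (Finset.mem_sdiff.1 hi).2)
      have h4 : partialNorm (T \ S) u ≤ partialNorm (T \ S) φ + F := by
        refine partialNorm_le_add fun i hi => ?_
        rw [hu i, hβ0 i (Finset.mem_sdiff.1 hi).2, zero_add]
        exact abs_add_le _ _
      linarith
    have e1 : (1 + 1 / ε) * D = D + 1 / ε * D := by ring
    have e2 : (6 + 2 / ε) * D = 6 * D + 2 * (1 / ε * D) := by ring
    have e3 : (6 + 2 / ε) * Z = 6 * Z + 2 * (1 / ε * Z) := by ring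
    have : 0 ≤ 1 / ε * Z := by positivity
    rw [e2, e3]
    rw [e1] at hF
    linarith

/-! ### One iteration and its contraction -/

variable {n p : ℕ} {X : Matrix (Fin n) (Fin p) ℝ}

/-- The rescaled correlations `Xᵀ e / n` of the columns with the noise. -/
def scaledNoise (X : Matrix (Fin n) (Fin p) ℝ) (e : EuclideanSpace ℝ (Fin n)) :
    EuclideanSpace ℝ (Fin p) :=
  (1 / (n : ℝ)) • X.transpose.toEuclideanLin e

/-- One iteration of hard thresholding pursuit halves the error, up to a noise term. -/
lemma IsStep.error_le {ε δ a : ℝ} {s : ℕ} {β b b' : EuclideanSpace ℝ (Fin p)}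
    {e : EuclideanSpace ℝ (Fin n)} (hn : 0 < n) (hε0 : 0 < ε) (hε1 : ε < 1)
    (hR : RIP X (3 * s) δ) (hδ : δ < min (ε ^ 2) 0.005) (hβs : l0 β ≤ s) (hb : l0 b ≤ s)
    (ha : 0 ≤ a) (hβ : ∀ i, β i ≠ 0 → (1 + 3 * ε) * a ≤ |β i|)
    (hstep : IsStep X (X.toEuclideanLin β + e) s b b') :
    l0 b' ≤ s ∧ ‖b' - β‖ ≤ ‖b - β‖ / 2
      + 2 * ((7 + 2 / ε) * partialNorm (supp β) (fun i => scaledNoise X e i)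
        + 2 * partialNorm (supp β)ᶜ (fun i => trunc ((1 + ε) * a) (scaledNoise X e i))
        + 2 * (a * √((s : ℝ) - l0 β))) := by
  obtain ⟨v, hv, hls⟩ := hstep
  set u := b + (1 / (n : ℝ)) •
    X.transpose.toEuclideanLin (X.toEuclideanLin β + e - X.toEuclideanLin b) with hudef
  change IsLeastSquaresOn X _ (supp v) b' at hls
  change (supp β).card ≤ s at hβs
  change (supp b).card ≤ s at hb
  obtain ⟨hTs, hord, hTcard⟩ := hv.supp_properties
  have hb's : (supp b').card ≤ s := (Finset.card_le_card hls.1.supp_subset).trans hTs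
  refine ⟨hb's, ?_⟩
  set S := supp β with hS
  set T := supp v with hT
  set z := scaledNoise X e with hz
  have hu : ∀ i, u i = β i + gramDefect X (b - β) i + z i := by
    intro i
    have : u = β + gramDefect X (b - β) + z := by
      simp only [hudef, gramDefect, hz, scaledNoise, map_sub, map_add, smul_sub, smul_add]
      abel
    rw [this]
    simp
  -- Three supports of size at most `s` explain the order `3s` in RIP; `b'` lives on `T`, so the
  -- same set carries both errors.
  have hU : (T ∪ S ∪ supp b).card ≤ 3 * s := by
    have h1 := Finset.card_union_le (T ∪ S) (supp b)
    have h2 := Finset.card_union_le T S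
    omega
  have hTU : T ⊆ T ∪ S ∪ supp b := Finset.subset_union_left.trans Finset.subset_union_left
  have hSU : S ⊆ T ∪ S ∪ supp b := Finset.subset_union_right.trans Finset.subset_union_left
  have hh : SupportedOn (T ∪ S ∪ supp b) (b - β) :=
    ((supportedOn_supp b).mono Finset.subset_union_right).sub ((supportedOn_supp β).mono hSU)
  have hh' : SupportedOn (T ∪ S ∪ supp b) (b' - β) :=
    (hls.1.mono hTU).sub ((supportedOn_supp β).mono hSU)
  have hDS := hR.partialNorm_gramDefect_le hn hU hSU hh
  have hDT := hR.partialNorm_gramDefect_le hn hU hTU hh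
  have hDT' := hR.partialNorm_gramDefect_le hn hU hTU hh'
  have hsel := missed_add_false_le (β := fun i => β i) (φ := fun i => gramDefect X (b - β) i)
    (z := fun i => z i) (u := fun i => u i) hε0 hε1 ha hu
    (supportedOn_supp β) (fun i hi => hβ i (by simpa [hS, supp] using hi)) hord hTs hβs
    (hTcard.imp_left fun h => (le_min hβs (by simpa using Finset.card_le_univ S)).trans h.ge) hDS hDT
  -- Orthogonality of the residual removes the gradient term on `T`, so there the new error is only
  -- its own Gram defect plus noise.
  have hfix : ∀ i ∈ T, (b' - β) i = gramDefect X (b' - β) i + z i := by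
    intro i hi
    have h0 := hls.transpose_residual_eq_zero hi
    have h1 : gramDefect X (b' - β) + z = (b' - β) + (1 / (n : ℝ)) •
        X.transpose.toEuclideanLin (X.toEuclideanLin β + e - X.toEuclideanLin b') := by
      simp only [gramDefect, hz, scaledNoise, map_sub, map_add, smul_sub, smul_add]
      abel
    have h2 := congrArg (fun w : EuclideanSpace ℝ (Fin p) => w i) h1
    simp only [PiLp.add_apply, PiLp.smul_apply, h0, smul_zero, add_zero] at h2
    exact h2.symm
  have hsplit : ‖b' - β‖ ≤ partialNorm T (fun i => (b' - β) i) + partialNorm (S \ T) (fun i => β i)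
      := by
    rw [← partialNorm_univ]
    refine (partialNorm_inter_add_sdiff _ T _).trans ?_
    rw [Finset.univ_inter]
    gcongr
    have hsub : S \ T ⊆ Finset.univ \ T := Finset.sdiff_subset_sdiff (Finset.subset_univ _) le_rfl
    refine Real.sqrt_le_sqrt (le_of_eq ?_)
    rw [← Finset.sum_subset hsub (f := fun i => (b' - β) i ^ 2)]
    · refine Finset.sum_congr rfl fun i hi => ?_
      simp [hls.1 i (Finset.mem_sdiff.1 hi).2]
    · intro i hi hiS
      have hiT := (Finset.mem_sdiff.1 hi).2
      have : i ∉ S := fun h => hiS (Finset.mem_sdiff.2 ⟨h, hiT⟩)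
      simp [hls.1 i hiT, supportedOn_supp β i this]
  have hT1 : partialNorm T (fun i => (b' - β) i) ≤
      partialNorm T (fun i => gramDefect X (b' - β) i) + partialNorm T (fun i => z i) :=
    partialNorm_le_add fun i hi => by
      rw [hfix i hi]
      exact abs_add_le _ _
  have hT2 : partialNorm T (fun i => z i) ≤
      partialNorm S (fun i => z i) + partialNorm (T \ S) (fun i => z i) := by
    refine (partialNorm_inter_add_sdiff _ S _).trans ?_
    gcongr
    exact partialNorm_mono Finset.inter_subset_right
  have hδ1 : δ < ε ^ 2 := hδ.trans_le (min_le_left _ _)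
  have hδ2 : δ < 0.005 := hδ.trans_le (min_le_right _ _)
  have hδ0 := hR.1
  -- Both bounds on `δ` multiply to `δ² ≤ 0.005 ε²`, and `0.071² > 0.005`. Hence `(6 + 2/ε)δ ≤ 0.03
  -- + 0.142`. After `0.005‖b' - β‖` is absorbed on the left, the contraction factor is below `1/2`.
  have hδε : 1 / ε * δ ≤ 0.071 := by
    rw [one_div, inv_mul_le_iff₀ hε0]
    refine (sq_le_sq₀ hδ0.le (by positivity)).1 ?_
    nlinarith
  have he := norm_nonneg (b - β)
  have he' := norm_nonneg (b' - β)
  have hc : (6 + 2 / ε) * (δ * ‖b - β‖) ≤ 0.172 * ‖b - β‖ := by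
    have : (6 + 2 / ε) * δ ≤ 0.172 := by
      have : (6 + 2 / ε) * δ = 6 * δ + 2 * (1 / ε * δ) := by ring
      rw [this]
      linarith
    rw [← mul_assoc]
    gcongr
  have hc' : δ * ‖b' - β‖ ≤ 0.005 * ‖b' - β‖ := by gcongr
  have hZ := partialNorm_nonneg S (fun i => z i)
  have hW := partialNorm_nonneg Sᶜ (fun i => trunc ((1 + ε) * a) (z i))
  have hτ : 0 ≤ a * √((s : ℝ) - S.card) := by positivity
  have hZ2 : 0 ≤ (6 + 2 / ε) * partialNorm S (fun i => z i) := by positivity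
  have e7 : (7 + 2 / ε) * partialNorm S (fun i => z i) =
      partialNorm S (fun i => z i) + (6 + 2 / ε) * partialNorm S (fun i => z i) := by ring
  change ‖b' - β‖ ≤ ‖b - β‖ / 2 + 2 * ((7 + 2 / ε) * partialNorm S (fun i => z i)
        + 2 * partialNorm Sᶜ (fun i => trunc ((1 + ε) * a) (z i))
        + 2 * (a * √((s : ℝ) - S.card)))
  rw [e7]
  linarith

lemma le_of_halving {e : ℕ → ℝ} {D : ℝ} (h : ∀ t, e (t + 1) ≤ e t / 2 + D) (t : ℕ) :
    e t ≤ (1 / 2) ^ t * e 0 + 2 * D * (1 - (1 / 2) ^ t) := by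
  induction t with
  | zero => simp
  | succ t ih =>
    refine (h t).trans ?_
    rw [pow_succ]
    linarith

/-! ### Exponential moments and truncated second moments -/

lemma integral_exp_sq_div_four_gaussianReal :
    ∫ x, Real.exp (x ^ 2 / 4) ∂(gaussianReal 0 1) = √2 := by
  rw [integral_gaussianReal_eq_integral_smul one_ne_zero]
  have h : ∀ x : ℝ, gaussianPDFReal 0 1 x • Real.exp (x ^ 2 / 4) =
      (√(2 * Real.pi))⁻¹ * Real.exp (-(1 / 4) * x ^ 2) := by
    intro x
    rw [gaussianPDFReal_def, smul_eq_mul, mul_assoc, ← Real.exp_add]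
    simp only [NNReal.coe_one, mul_one, sub_zero]
    congr 2
    ring
  simp_rw [h]
  rw [integral_const_mul, integral_gaussian, ← Real.sqrt_inv, ← Real.sqrt_mul (by positivity)]
  congr 1
  field_simp
  norm_num

lemma lintegral_pi_prod_ofReal {ι : Type*} [Fintype ι] {μ : Measure ℝ} [SigmaFinite μ]
    {f : ι → ℝ → ℝ} (hf : ∀ i, Integrable (f i) μ) (h0 : ∀ i x, 0 ≤ f i x) :
    ∫⁻ g : ι → ℝ, ENNReal.ofReal (∏ i, f i (g i)) ∂(Measure.pi fun _ => μ) =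
      ENNReal.ofReal (∏ i, ∫ x, f i x ∂μ) := by
  rw [← ofReal_integral_eq_lintegral_ofReal (Integrable.fintype_prod hf)
    (Filter.Eventually.of_forall fun g => Finset.prod_nonneg fun i _ => h0 i _),
    integral_fintype_prod_eq_prod]

/-- If all linear functionals of `Y` are sub-Gaussian with variance proxy at most `1 / 2`, then
`‖Y‖² / 2` has an exponential moment. -/
lemma lintegral_exp_half_sum_sq_le {Ω ι : Type*} [MeasurableSpace Ω] [Fintype ι] {P : Measure Ω}
    [IsProbabilityMeasure P] {Y : ι → Ω → ℝ} (hY : ∀ i, Measurable (Y i))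
    (h : ∀ g : ι → ℝ, ∫⁻ ω, ENNReal.ofReal (Real.exp (∑ i, g i * Y i ω)) ∂P ≤
      ENNReal.ofReal (Real.exp (∑ i, g i ^ 2 / 4))) :
    ∫⁻ ω, ENNReal.ofReal (Real.exp ((∑ i, Y i ω ^ 2) / 2)) ∂P ≤
      ENNReal.ofReal (√2 ^ Fintype.card ι) := by
  set γ : Measure (ι → ℝ) := Measure.pi fun _ => gaussianReal 0 1
  have hmgf : ∀ y : ℝ, ∫ x, Real.exp (x * y) ∂(gaussianReal 0 1) = Real.exp (y ^ 2 / 2) := by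
    intro y
    have := congrFun (mgf_fun_id_gaussianReal (μ := 0) (v := 1)) y
    simp only [mgf] at this
    simpa [mul_comm] using this
  have hint : ∀ {f : ℝ → ℝ}, (∫ x, f x ∂(gaussianReal 0 1)) ≠ 0 →
      Integrable f (gaussianReal 0 1) := fun hf => not_imp_comm.1 integral_undef hf
  -- Linearize the square: `exp(‖Y‖²/2)` is the mean of `exp⟨g, Y⟩` over a standard Gaussian `g`.
  -- Tonelli allows `Y` to be integrated first, leaving a product of one-dimensional Gaussian
  -- integrals.
  calc ∫⁻ ω, ENNReal.ofReal (Real.exp ((∑ i, Y i ω ^ 2) / 2)) ∂P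
      = ∫⁻ ω, ∫⁻ g, ENNReal.ofReal (Real.exp (∑ i, g i * Y i ω)) ∂γ ∂P := by
        refine lintegral_congr fun ω => ?_
        simp_rw [Real.exp_sum]
        rw [lintegral_pi_prod_ofReal (f := fun i x => Real.exp (x * Y i ω))
          (fun i => hint (by rw [hmgf]; exact (Real.exp_pos _).ne')) (fun _ _ => (Real.exp_pos _).le)]
        simp_rw [hmgf]
        rw [← Real.exp_sum, Finset.sum_div]
    _ = ∫⁻ g, ∫⁻ ω, ENNReal.ofReal (Real.exp (∑ i, g i * Y i ω)) ∂P ∂γ := by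
        refine lintegral_lintegral_swap (Measurable.aemeasurable ?_)
        unfold Function.uncurry
        fun_prop
    _ ≤ ∫⁻ g, ENNReal.ofReal (∏ i, Real.exp (g i ^ 2 / 4)) ∂γ := by
        simp_rw [← Real.exp_sum]
        exact lintegral_mono h
    _ = ENNReal.ofReal (√2 ^ Fintype.card ι) := by
        rw [lintegral_pi_prod_ofReal (f := fun _ x => Real.exp (x ^ 2 / 4))
          (fun i => hint (by rw [integral_exp_sq_div_four_gaussianReal]; positivity))
          (fun _ _ => (Real.exp_pos _).le)]
        simp [integral_exp_sq_div_four_gaussianReal]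

/-- Chernoff bound with exponent `c + 1` instead of the optimal `c`: the extra 1 provides `exp(y -
c)` to dominate `y²`, and costs only a factor `exp(1/2)` in the sub-Gaussian moment. -/
lemma sq_trunc_le (c x : ℝ) (hc : 0 ≤ c) :
    trunc c x ^ 2 ≤ (2 * c ^ 2 + 4) * (Real.exp (-((c + 1) * c)) *
      (Real.exp ((c + 1) * x) + Real.exp (-(c + 1) * x))) := by
  have key : ∀ y, c < y → y ^ 2 ≤ (2 * c ^ 2 + 4) *
      (Real.exp (-((c + 1) * c)) * Real.exp ((c + 1) * y)) := by
    intro y hy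
    set d := y - c with hd
    have hd0 : 0 < d := by linarith
    have h1 : 1 + d + d ^ 2 / 2 ≤ Real.exp d := Real.quadratic_le_exp_of_nonneg hd0.le
    have h2 : Real.exp d ≤ Real.exp (-((c + 1) * c)) * Real.exp ((c + 1) * y) := by
      rw [← Real.exp_add]
      refine Real.exp_le_exp.2 ?_
      have : y = c + d := by linarith
      rw [this]
      nlinarith
    have h3 : y ^ 2 ≤ (2 * c ^ 2 + 4) * Real.exp d := by
      have : y = c + d := by linarith
      rw [this]
      nlinarith [sq_nonneg (c - d), sq_nonneg c, sq_nonneg (c * d)]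
    exact h3.trans (mul_le_mul_of_nonneg_left h2 (by positivity))
  unfold trunc
  split_ifs with h
  · rcases lt_abs.1 h with h | h
    · refine (key x h).trans ?_
      gcongr
      exact le_add_of_nonneg_right (Real.exp_pos _).le
    · have := key (-x) h
      rw [neg_sq] at this
      refine this.trans ?_
      gcongr
      rw [show (c + 1) * -x = -(c + 1) * x by ring]
      exact le_add_of_nonneg_left (Real.exp_pos _).le
  · have : (0 : ℝ) ≤ (2 * c ^ 2 + 4) * (Real.exp (-((c + 1) * c)) *
      (Real.exp ((c + 1) * x) + Real.exp (-(c + 1) * x))) := by positivity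
    simpa using this

lemma measurable_trunc (c : ℝ) : Measurable (trunc c) := by
  unfold trunc
  exact Measurable.ite (measurableSet_lt measurable_const measurable_id.abs) measurable_id
    measurable_const

lemma measurable_sq_trunc_ofReal {Ω : Type*} [MeasurableSpace Ω] {x : Ω → ℝ} (hx : Measurable x)
    (c : ℝ) : Measurable fun ω => ENNReal.ofReal (trunc c (x ω) ^ 2) :=
  (((measurable_trunc c).comp hx).pow_const 2).ennreal_ofReal

/-- The second moment of the tail of a standard sub-Gaussian variable. -/
lemma lintegral_sq_trunc_le {Ω : Type*} [MeasurableSpace Ω] {P : Measure Ω} {x : Ω → ℝ}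
    (hx : Measurable x) {c : ℝ} (hc : 0 ≤ c)
    (h : ∀ u : ℝ, ∫⁻ ω, ENNReal.ofReal (Real.exp (u * x ω)) ∂P ≤
      ENNReal.ofReal (Real.exp (u ^ 2 / 2))) :
    ∫⁻ ω, ENNReal.ofReal (trunc c (x ω) ^ 2) ∂P ≤
      ENNReal.ofReal ((8 * c ^ 2 + 16) * Real.exp (-(c ^ 2 / 2))) := by
  have hK : 0 ≤ (2 * c ^ 2 + 4) * Real.exp (-((c + 1) * c)) := by positivity
  calc ∫⁻ ω, ENNReal.ofReal (trunc c (x ω) ^ 2) ∂P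
      ≤ ∫⁻ ω, ENNReal.ofReal ((2 * c ^ 2 + 4) * Real.exp (-((c + 1) * c))) *
          (ENNReal.ofReal (Real.exp ((c + 1) * x ω)) +
            ENNReal.ofReal (Real.exp (-(c + 1) * x ω))) ∂P := by
        refine lintegral_mono fun ω => ?_
        rw [← ENNReal.ofReal_add (Real.exp_pos _).le (Real.exp_pos _).le, ← ENNReal.ofReal_mul hK,
          mul_assoc]
        exact ENNReal.ofReal_le_ofReal (sq_trunc_le c (x ω) hc)
    _ ≤ ENNReal.ofReal ((2 * c ^ 2 + 4) * Real.exp (-((c + 1) * c))) *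
          (ENNReal.ofReal (Real.exp ((c + 1) ^ 2 / 2)) +
            ENNReal.ofReal (Real.exp ((-(c + 1)) ^ 2 / 2))) := by
        rw [lintegral_const_mul _ (by fun_prop), lintegral_add_left (by fun_prop)]
        gcongr
        · exact h _
        · exact h _
    _ ≤ ENNReal.ofReal ((8 * c ^ 2 + 16) * Real.exp (-(c ^ 2 / 2))) := by
        rw [← ENNReal.ofReal_add (Real.exp_pos _).le (Real.exp_pos _).le, ← ENNReal.ofReal_mul hK]
        refine ENNReal.ofReal_le_ofReal ?_
        have e1 : (2 * c ^ 2 + 4) * Real.exp (-((c + 1) * c)) *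
            (Real.exp ((c + 1) ^ 2 / 2) + Real.exp ((-(c + 1)) ^ 2 / 2)) =
            (2 * c ^ 2 + 4) * (2 * Real.exp (1 / 2)) * Real.exp (-(c ^ 2 / 2)) := by
          have : Real.exp (-((c + 1) * c)) * Real.exp ((c + 1) ^ 2 / 2) =
              Real.exp (1 / 2) * Real.exp (-(c ^ 2 / 2)) := by
            rw [← Real.exp_add, ← Real.exp_add]
            congr 1
            ring
          rw [neg_sq]
          linear_combination 2 * (2 * c ^ 2 + 4) * this
        have e2 : Real.exp (1 / 2) ≤ 2 := by
          have h1 : Real.exp (1 / 2) ^ 2 = Real.exp 1 := by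
            rw [← Real.exp_nat_mul]; norm_num
          have h2 := Real.exp_one_lt_d9
          nlinarith [Real.exp_pos (1 / 2)]
        rw [e1]
        gcongr
        nlinarith [sq_nonneg c]

/-- The noise as a random vector. -/
def noise {Ω : Type*} {n : ℕ} (ξ : Fin n → Ω → ℝ) (ω : Ω) : EuclideanSpace ℝ (Fin n) :=
  WithLp.toLp 2 fun i => ξ i ω

lemma inner_noise {Ω : Type*} {n : ℕ} (ξ : Fin n → Ω → ℝ) (v : EuclideanSpace ℝ (Fin n))
    (ω : Ω) :
    inner ℝ v (noise ξ ω) = ∑ i, v i * ξ i ω := by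
  simp [noise, PiLp.inner_apply, mul_comm]

/-! ### Tail bounds for the noise -/

section Noise

variable {Ω : Type*} [MeasurableSpace Ω] {P : Measure Ω} {n : ℕ}
  {ξ : Fin n → Ω → ℝ} {σ : ℝ}

lemma IsSubGaussianNoise.lintegral_exp_inner_le (hξ : IsSubGaussianNoise P ξ σ)
    (v : EuclideanSpace ℝ (Fin n)) :
    ∫⁻ ω, ENNReal.ofReal (Real.exp (inner ℝ v (noise ξ ω))) ∂P ≤
      ENNReal.ofReal (Real.exp (σ ^ 2 * ‖v‖ ^ 2 / 2)) := by
  have hind : iIndepFun (fun i ω => v i * ξ i ω) P :=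
    hξ.indep.comp (fun i x => v i * x) fun i => measurable_const_mul _
  have hsub := HasSubgaussianMGF.sum_of_iIndepFun hind (s := Finset.univ)
    (fun i _ => (hξ.subGaussian i).const_mul (v i))
  have hint := hsub.integrable_exp_mul 1
  have hle := hsub.mgf_le 1
  simp only [mgf, one_mul] at hint hle
  simp_rw [inner_noise]
  rw [← ofReal_integral_eq_lintegral_ofReal hint
    (Filter.Eventually.of_forall fun _ => (Real.exp_pos _).le)]
  refine ENNReal.ofReal_le_ofReal (hle.trans (le_of_eq ?_))
  have hc : ∀ i, ((⟨v i ^ 2, sq_nonneg _⟩ * (σ ^ 2).toNNReal : NNReal) : ℝ) = v i ^ 2 * σ ^ 2 := by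
    intro i
    change v i ^ 2 * ((σ ^ 2).toNNReal : ℝ) = _
    rw [Real.coe_toNNReal _ (sq_nonneg σ)]
  rw [NNReal.coe_sum, Finset.sum_congr rfl fun i _ => hc i, ← Finset.sum_mul,
    EuclideanSpace.real_norm_sq_eq]
  congr 1
  ring

end Noise

section Tails

variable {Ω : Type*} [MeasurableSpace Ω] {P : Measure Ω} {n p : ℕ}
  {ξ : Fin n → Ω → ℝ} {σ : ℝ} {X : Matrix (Fin n) (Fin p) ℝ}

lemma inner_scaledNoise (w : EuclideanSpace ℝ (Fin p)) (e : EuclideanSpace ℝ (Fin n)) :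
    inner ℝ w (scaledNoise X e) = 1 / (n : ℝ) * inner ℝ (X.toEuclideanLin w) e := by
  rw [scaledNoise, inner_smul_right, inner_toEuclideanLin]

lemma scaledNoise_apply (e : EuclideanSpace ℝ (Fin n)) (j : Fin p) :
    scaledNoise X e j = inner ℝ (EuclideanSpace.single j (1 : ℝ)) (scaledNoise X e) := by
  rw [EuclideanSpace.inner_single_left]
  simp

lemma IsSubGaussianNoise.measurable_scaledNoise (hξ : IsSubGaussianNoise P ξ σ) (j : Fin p) :
    Measurable fun ω => scaledNoise X (noise ξ ω) j := by
  have hm := hξ.measurable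
  simp_rw [scaledNoise_apply, inner_scaledNoise, inner_noise]
  fun_prop

lemma IsSubGaussianNoise.lintegral_exp_inner_scaledNoise_le (hξ : IsSubGaussianNoise P ξ σ)
    (w : EuclideanSpace ℝ (Fin p)) (c : ℝ) :
    ∫⁻ ω, ENNReal.ofReal (Real.exp (c * inner ℝ w (scaledNoise X (noise ξ ω)))) ∂P ≤
      ENNReal.ofReal (Real.exp (σ ^ 2 * (c / n) ^ 2 * ‖X.toEuclideanLin w‖ ^ 2 / 2)) := by
  have h := hξ.lintegral_exp_inner_le ((c / n) • X.toEuclideanLin w)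
  rw [norm_smul, mul_pow, Real.norm_eq_abs, sq_abs, ← mul_assoc] at h
  refine le_trans (le_of_eq (lintegral_congr fun ω => ?_)) h
  rw [inner_scaledNoise, real_inner_smul_left]
  congr 2
  ring

/-- The noise on a set of `m` columns has norm of order `σ (m / n)^{1/2}`. -/
lemma IsSubGaussianNoise.measure_partialNorm_ge_le [IsProbabilityMeasure P]
    (hξ : IsSubGaussianNoise P ξ σ) (hn : 0 < n) (hσ : 0 < σ) {k : ℕ} {δ : ℝ} (hR : RIP X k δ)
    {V : Finset (Fin p)} (hV : V.card ≤ k) :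
    P {ω | 16 * (σ ^ 2 * V.card / n) ≤ partialNorm V (fun i => scaledNoise X (noise ξ ω) i) ^ 2} ≤
      ENNReal.ofReal (Real.exp (-(V.card : ℝ))) := by
  have hn' : (0 : ℝ) < n := by exact_mod_cast hn
  -- With this scale and `1 + δ ≤ 2`, every linear functional of `Y` has variance proxy at most
  -- `1/2`. The threshold 16 then corresponds to `‖Y‖² / 2 ≥ 2|V|`, leaving `exp(-|V|)` after the
  -- moment `√2 ^ |V|` is bounded by `exp |V|`.
  set c : ℝ := √n / (2 * σ) with hc
  have hc2 : c ^ 2 = n / (4 * σ ^ 2) := by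
    rw [hc, div_pow, Real.sq_sqrt hn'.le]; ring
  set Y : V → Ω → ℝ := fun i ω => c * scaledNoise X (noise ξ ω) i with hYdef
  have hYm : ∀ i, Measurable (Y i) := fun i => (hξ.measurable_scaledNoise i.1).const_mul c
  have hY : ∀ g : V → ℝ, ∫⁻ ω, ENNReal.ofReal (Real.exp (∑ i, g i * Y i ω)) ∂P ≤
      ENNReal.ofReal (Real.exp (∑ i, g i ^ 2 / 4)) := by
    intro g
    set w : EuclideanSpace ℝ (Fin p) :=
      WithLp.toLp 2 (fun i => if h : i ∈ V then g ⟨i, h⟩ else 0) with hw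
    have hwV : SupportedOn V w := fun i hi => by simp [w, hi]
    have hwg : ∀ i : V, w i = g i := fun i => by simp [w]
    have hsum : ∀ ω, ∑ i, g i * Y i ω = c * inner ℝ w (scaledNoise X (noise ξ ω)) := by
      intro ω
      simp_rw [← hwg, hYdef]
      rw [Finset.sum_coe_sort V (fun i => w i * (c * scaledNoise X (noise ξ ω) i)),
        Finset.sum_subset (Finset.subset_univ V) (fun i _ hi => by rw [hwV i hi, zero_mul]),
        PiLp.inner_apply, Finset.mul_sum]
      refine Finset.sum_congr rfl fun i _ => ?_
      simp only [RCLike.inner_apply, conj_trivial]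
      ring
    have hnorm : ∑ i, g i ^ 2 / 4 = ‖w‖ ^ 2 / 4 := by
      simp_rw [← hwg]
      rw [Finset.sum_coe_sort V (fun i => w i ^ 2 / 4),
        Finset.sum_subset (Finset.subset_univ V) (fun i _ hi => by rw [hwV i hi]; norm_num),
        EuclideanSpace.real_norm_sq_eq, Finset.sum_div]
    simp_rw [hsum]
    rw [hnorm]
    refine (hξ.lintegral_exp_inner_scaledNoise_le w c).trans (ENNReal.ofReal_le_ofReal
      (Real.exp_le_exp.2 ?_))
    have h1 := (hR.norm_sq_bounds hn hV hwV).2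
    have h2 : σ ^ 2 * (c / n) ^ 2 * ‖X.toEuclideanLin w‖ ^ 2 / 2 =
        (1 / (n : ℝ) * ‖X.toEuclideanLin w‖ ^ 2) / 8 := by
      rw [div_pow, hc2]; field_simp; ring
    rw [h2]
    nlinarith [hR.2.1, sq_nonneg ‖w‖]
  have hmom := lintegral_exp_half_sum_sq_le hYm hY
  have hsq : ∀ ω, ∑ i, Y i ω ^ 2 =
      c ^ 2 * partialNorm V (fun i => scaledNoise X (noise ξ ω) i) ^ 2 := by
    intro ω
    rw [partialNorm_sq, Finset.mul_sum, ← Finset.sum_coe_sort V]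
    exact Finset.sum_congr rfl fun i _ => mul_pow _ _ _
  have hmark := mul_meas_ge_le_lintegral (μ := P)
    (f := fun ω => ENNReal.ofReal (Real.exp ((∑ i, Y i ω ^ 2) / 2))) (by fun_prop)
    (ENNReal.ofReal (Real.exp (2 * V.card)))
  have hsub : P {ω | 16 * (σ ^ 2 * V.card / n) ≤
        partialNorm V (fun i => scaledNoise X (noise ξ ω) i) ^ 2} ≤
      P {ω | ENNReal.ofReal (Real.exp (2 * V.card)) ≤
        ENNReal.ofReal (Real.exp ((∑ i, Y i ω ^ 2) / 2))} := by
    refine measure_mono fun ω hω => ENNReal.ofReal_le_ofReal (Real.exp_le_exp.2 ?_)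
    have hω' : 16 * (σ ^ 2 * V.card / n) ≤
      partialNorm V (fun i => scaledNoise X (noise ξ ω) i) ^ 2 := hω
    rw [hsq]
    have h1 := mul_le_mul_of_nonneg_left hω' (sq_nonneg c)
    have h2 : c ^ 2 * (16 * (σ ^ 2 * V.card / n)) = 4 * V.card := by
      rw [hc2]; field_simp; norm_num
    linarith
  refine hsub.trans ?_
  have hpos := Real.exp_pos (2 * (V.card : ℝ))
  refine (ENNReal.mul_le_mul_iff_right (ENNReal.ofReal_pos.2 hpos).ne' ENNReal.ofReal_ne_top).1 ?_
  refine (hmark.trans hmom).trans ?_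
  rw [← ENNReal.ofReal_mul hpos.le, ← Real.exp_add, Fintype.card_coe]
  refine ENNReal.ofReal_le_ofReal ?_
  have h2 : √2 ≤ Real.exp 1 := by
    have h3 : √2 ≤ 2 := Real.sqrt_le_iff.2 ⟨by norm_num, by norm_num⟩
    have := Real.add_one_le_exp (1 : ℝ)
    linarith
  calc √2 ^ V.card ≤ Real.exp 1 ^ V.card := pow_le_pow_left₀ (Real.sqrt_nonneg _) h2 _
    _ = Real.exp (2 * V.card + -V.card) := by
        rw [← Real.exp_nat_mul]
        congr 1
        ring

lemma trunc_mul {κ : ℝ} (hκ : 0 < κ) (c x : ℝ) : trunc (κ * c) (κ * x) = κ * trunc c x := by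
  unfold trunc
  simp only [abs_mul, abs_of_pos hκ, mul_lt_mul_iff_right₀ hκ, mul_ite, mul_zero]

lemma norm_toEuclideanLin_single_sq (hX : ∀ j, ∑ i, X i j ^ 2 = (n : ℝ)) (j : Fin p) :
    ‖X.toEuclideanLin (EuclideanSpace.single j (1 : ℝ))‖ ^ 2 = n := by
  rw [EuclideanSpace.real_norm_sq_eq, ← hX j]
  refine Finset.sum_congr rfl fun i _ => ?_
  simp [Matrix.toLpLin_apply]

/-- The expected squared norm of the part of the noise above a threshold. -/
lemma IsSubGaussianNoise.lintegral_sq_partialNorm_trunc_le (hξ : IsSubGaussianNoise P ξ σ)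
    (hn : 0 < n) (hσ : 0 < σ) (hX : ∀ j, ∑ i, X i j ^ 2 = (n : ℝ)) {c : ℝ} (hc : 0 ≤ c)
    (V : Finset (Fin p)) :
    ∫⁻ ω, ENNReal.ofReal (partialNorm V
        (fun i => trunc (σ / √n * c) (scaledNoise X (noise ξ ω) i)) ^ 2) ∂P ≤
      ENNReal.ofReal (p * (σ ^ 2 / n * ((8 * c ^ 2 + 16) * Real.exp (-(c ^ 2 / 2))))) := by
  have hn' : (0 : ℝ) < n := by exact_mod_cast hn
  have hsn : 0 < √(n : ℝ) := Real.sqrt_pos.2 hn'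
  have hκ : 0 < σ / √(n : ℝ) := by positivity
  set κ := σ / √(n : ℝ) with hκdef
  have hκ2 : κ ^ 2 = σ ^ 2 / n := by rw [hκdef, div_pow, Real.sq_sqrt hn'.le]
  have hterm : ∀ j, ∫⁻ ω, ENNReal.ofReal (trunc (κ * c) (scaledNoise X (noise ξ ω) j) ^ 2) ∂P ≤
      ENNReal.ofReal (σ ^ 2 / n * ((8 * c ^ 2 + 16) * Real.exp (-(c ^ 2 / 2)))) := by
    intro j
    have hm : Measurable fun ω => κ⁻¹ * scaledNoise X (noise ξ ω) j :=
      (hξ.measurable_scaledNoise j).const_mul _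
    have h1 := lintegral_sq_trunc_le (P := P) hm hc fun u => by
      have h := hξ.lintegral_exp_inner_scaledNoise_le (X := X)
        (EuclideanSpace.single j (1 : ℝ)) (u * κ⁻¹)
      simp_rw [← scaledNoise_apply] at h
      rw [norm_toEuclideanLin_single_sq hX] at h
      have e : σ ^ 2 * (u * κ⁻¹ / n) ^ 2 * n / 2 = u ^ 2 / 2 := by
        rw [div_pow, mul_pow, inv_pow, hκ2]
        field_simp
      rw [e] at h
      simp_rw [← mul_assoc]
      exact h
    have h2 : ∀ ω, ENNReal.ofReal (trunc (κ * c) (scaledNoise X (noise ξ ω) j) ^ 2) =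
        ENNReal.ofReal (σ ^ 2 / n) *
          ENNReal.ofReal (trunc c (κ⁻¹ * scaledNoise X (noise ξ ω) j) ^ 2) := by
      intro ω
      rw [← ENNReal.ofReal_mul (by positivity), ← hκ2, ← mul_pow, ← trunc_mul hκ,
        mul_inv_cancel_left₀ hκ.ne']
    simp_rw [h2]
    rw [lintegral_const_mul _ (measurable_sq_trunc_ofReal hm c),
      ENNReal.ofReal_mul (by positivity)]
    gcongr
  simp_rw [partialNorm_sq]
  simp_rw [ENNReal.ofReal_sum_of_nonneg fun (i : Fin p) (_ : i ∈ V) => sq_nonneg _]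
  rw [lintegral_finsetSum V fun j _ =>
    measurable_sq_trunc_ofReal (hξ.measurable_scaledNoise j) _]
  refine (Finset.sum_le_sum fun j _ => hterm j).trans ?_
  rw [Finset.sum_const, ENNReal.ofReal_mul (Nat.cast_nonneg p), ENNReal.ofReal_natCast,
    nsmul_eq_mul]
  gcongr
  simpa using Finset.card_le_univ V

/-- The part of the noise above the level `(1 + ε) σ (2 log (p / m) / n)^{1/2}` has norm of order
`σ (m / n)^{1/2}`. -/
lemma IsSubGaussianNoise.measure_partialNorm_trunc_ge_le (hξ : IsSubGaussianNoise P ξ σ)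
    (hn : 0 < n) (hσ : 0 < σ) (hX : ∀ j, ∑ i, X i j ^ 2 = (n : ℝ)) {ε : ℝ} (hε0 : 0 < ε)
    (hε1 : ε < 1) {m : ℕ} (hm : 0 < m) (hmp : m ≤ p) (V : Finset (Fin p)) :
    P {ω | 64 * (1 + 1 / ε) * (σ ^ 2 * m / n) ≤ partialNorm V (fun i =>
        trunc ((1 + ε) * (σ * √(2 * Real.log (p / m) / n))) (scaledNoise X (noise ξ ω) i)) ^ 2} ≤
      ENNReal.ofReal (((m : ℝ) / p) ^ ε) := by
  have hn' : (0 : ℝ) < n := by exact_mod_cast hn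
  have hm' : (0 : ℝ) < m := by exact_mod_cast hm
  have hmp' : (m : ℝ) ≤ p := by exact_mod_cast hmp
  have hp' : (0 : ℝ) < p := hm'.trans_le hmp'
  set L := Real.log (p / m) with hL
  have hL0 : 0 ≤ L := Real.log_nonneg ((one_le_div hm').2 hmp')
  have hexpL : Real.exp L = p / m := Real.exp_log (by positivity)
  have hpow : ((m : ℝ) / p) ^ ε = Real.exp (-(ε * L)) := by
    rw [Real.rpow_def_of_pos (by positivity), ← inv_div, Real.log_inv]
    congr 1
    ring
  set c := (1 + ε) * √(2 * L) with hc
  have hc2 : c ^ 2 = (1 + ε) ^ 2 * (2 * L) := by rw [hc, mul_pow, Real.sq_sqrt (by positivity)]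
  have hthr : (1 + ε) * (σ * √(2 * L / n)) = σ / √n * c := by
    rw [Real.sqrt_div (by positivity), hc]; ring
  rw [hthr]
  have hmom := hξ.lintegral_sq_partialNorm_trunc_le hn hσ hX (by positivity : 0 ≤ c) V
  have hmeas : Measurable fun ω => ENNReal.ofReal (partialNorm V
      (fun i => trunc (σ / √n * c) (scaledNoise X (noise ξ ω) i)) ^ 2) := by
    simp_rw [partialNorm_sq]
    exact (Finset.measurable_sum V fun j _ =>
      ((measurable_trunc _).comp (hξ.measurable_scaledNoise j)).pow_const 2).ennreal_ofReal
  set r := 64 * (1 + 1 / ε) * (σ ^ 2 * m / n) with hr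
  have hr0 : 0 < r := by positivity
  have hmark := mul_meas_ge_le_lintegral (μ := P) hmeas (ENNReal.ofReal r)
  have hsub : P {ω | r ≤ partialNorm V
        (fun i => trunc (σ / √n * c) (scaledNoise X (noise ξ ω) i)) ^ 2} ≤
      P {ω | ENNReal.ofReal r ≤ ENNReal.ofReal (partialNorm V
        (fun i => trunc (σ / √n * c) (scaledNoise X (noise ξ ω) i)) ^ 2)} :=
    measure_mono fun ω hω => ENNReal.ofReal_le_ofReal hω
  refine hsub.trans ((ENNReal.mul_le_mul_iff_right (ENNReal.ofReal_pos.2 hr0).ne'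
    ENNReal.ofReal_ne_top).1 ((hmark.trans hmom).trans ?_))
  rw [← ENNReal.ofReal_mul hr0.le, hpow]
  refine ENNReal.ofReal_le_ofReal ?_
  have h1 : (p : ℝ) = m * Real.exp L := by rw [hexpL]; field_simp
  -- Here `c²/2 = (1 + ε)²L ≥ L + 2εL`. The `L` cancels the factor `p/m`; one `exp(-εL)` absorbs the
  -- polynomial factor in `L`, and the other is the final probability.
  have h2 : Real.exp L * Real.exp (-(c ^ 2 / 2)) ≤ Real.exp (-(ε * L)) * Real.exp (-(ε * L)) := by
    rw [← Real.exp_add, ← Real.exp_add, hc2]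
    refine Real.exp_le_exp.2 ?_
    nlinarith [mul_nonneg (sq_nonneg ε) hL0]
  have h3 : 8 * c ^ 2 + 16 ≤ 64 * (L + 1) := by
    rw [hc2]
    have : (1 + ε) ^ 2 ≤ 4 := by nlinarith
    nlinarith
  have h4 : (L + 1) * Real.exp (-(ε * L)) ≤ 1 + 1 / ε := by
    have h5 := Real.add_one_le_exp (ε * L)
    rw [Real.exp_neg, ← div_eq_mul_inv, div_le_iff₀ (Real.exp_pos _)]
    calc L + 1 ≤ (1 + 1 / ε) * (ε * L + 1) := by
          have e : (1 + 1 / ε) * (ε * L + 1) = L + 1 + ε * L + 1 / ε := by field_simp; ring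
          rw [e]
          have : 0 ≤ ε * L := by positivity
          have : 0 ≤ 1 / ε := by positivity
          linarith
      _ ≤ _ := by gcongr
  calc (p : ℝ) * (σ ^ 2 / n * ((8 * c ^ 2 + 16) * Real.exp (-(c ^ 2 / 2))))
      = (σ ^ 2 * m / n) * ((8 * c ^ 2 + 16) * (Real.exp L * Real.exp (-(c ^ 2 / 2)))) := by
        rw [h1]; ring
    _ ≤ (σ ^ 2 * m / n) *
        (64 * (L + 1) * (Real.exp (-(ε * L)) * Real.exp (-(ε * L)))) := by gcongr
    _ = 64 * ((L + 1) * Real.exp (-(ε * L))) * (σ ^ 2 * m / n) * Real.exp (-(ε * L)) := by ring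
    _ ≤ r * Real.exp (-(ε * L)) := by rw [hr]; gcongr

end Tails

/-! ### Iteration and combination of the two noise events -/

lemma le_of_mem_signalClass {p sstar : ℕ} {lam : ℝ} {β : EuclideanSpace ℝ (Fin p)}
    (hβ : β ∈ signalClass p sstar lam) : sstar ≤ p := by
  have h : (supp β).card = sstar := hβ.1
  rw [← h]
  simpa using Finset.card_le_univ (supp β)

lemma IsRun.error_le {n p : ℕ} {X : Matrix (Fin n) (Fin p) ℝ} {ε δ a A R : ℝ} {s : ℕ}
    {β : EuclideanSpace ℝ (Fin p)} {b : ℕ → EuclideanSpace ℝ (Fin p)}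
    {e : EuclideanSpace ℝ (Fin n)} (hn : 0 < n) (hε0 : 0 < ε) (hε1 : ε < 1)
    (hR : RIP X (3 * s) δ) (hδ : δ < min (ε ^ 2) 0.005) (hβs : l0 β ≤ s) (hb : l0 (b 0) ≤ s)
    (ha : 0 ≤ a) (hβ : ∀ i, β i ≠ 0 → (1 + 3 * ε) * a ≤ |β i|)
    (hrun : IsRun X (X.toEuclideanLin β + e) s b)
    (hZ : partialNorm (supp β) (fun i => scaledNoise X e i) ≤ 4 * R)
    (hW : partialNorm (supp β)ᶜ (fun i => trunc ((1 + ε) * a) (scaledNoise X e i)) ≤ A * R)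
    (hτ : a * √((s : ℝ) - l0 β) ≤ 2 * R) (t : ℕ) :
    ‖b t - β‖ ≤ (1 / 2) ^ t * ‖b 0 - β‖ + 4 * ((7 + 2 / ε) * 4 + 2 * A + 4) * R := by
  have hs : ∀ t, l0 (b t) ≤ s := by
    intro t
    induction t with
    | zero => exact hb
    | succ t ih => exact ((hrun t).error_le hn hε0 hε1 hR hδ hβs ih ha hβ).1
  set D := 2 * ((7 + 2 / ε) * partialNorm (supp β) (fun i => scaledNoise X e i)
        + 2 * partialNorm (supp β)ᶜ (fun i => trunc ((1 + ε) * a) (scaledNoise X e i))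
        + 2 * (a * √((s : ℝ) - l0 β)))
  have hD0 : 0 ≤ D := by
    have h1 := partialNorm_nonneg (supp β) (fun i => scaledNoise X e i)
    have h2 := partialNorm_nonneg (supp β)ᶜ (fun i => trunc ((1 + ε) * a) (scaledNoise X e i))
    positivity
  have hD : D ≤ 2 * ((7 + 2 / ε) * (4 * R) + 2 * (A * R) + 2 * (2 * R)) := by
    simp only [D]
    gcongr
  have h := le_of_halving (e := fun t => ‖b t - β‖) (D := D)
    (fun t => ((hrun t).error_le hn hε0 hε1 hR hδ hβs (hs t) ha hβ).2) t
  have h2 : 2 * D * (1 - (1 / 2) ^ t) ≤ 2 * D :=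
    mul_le_of_le_one_right (by positivity) (sub_le_self _ (by positivity))
  linarith

/-- The probability that the error after `t` iterations exceeds a multiple of `R`. -/
lemma measure_error_ge_le {Ω : Type*} [MeasurableSpace Ω] {P : Measure Ω} [IsProbabilityMeasure P]
    {n p sstar s t : ℕ} {X : Matrix (Fin n) (Fin p) ℝ} {ξ : Fin n → Ω → ℝ} {ε σ lam δ C₁ R : ℝ}
    (hε0 : 0 < ε) (hε1 : ε < 1) (hn : 0 < n) (hs1 : 1 ≤ sstar) (hσ : 0 < σ)
    (hX : ∀ j, ∑ i, X i j ^ 2 = (n : ℝ)) (hR : RIP X (3 * s) δ) (hδ : δ < min (ε ^ 2) 0.005)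
    (hlam : (1 + 3 * ε) * σ * √(2 * Real.log (p / sstar) / n) ≤ lam)
    (hξ : IsSubGaussianNoise P ξ σ) {β : EuclideanSpace ℝ (Fin p)}
    (hβ : β ∈ signalClass p sstar lam) {b : ℕ → Ω → EuclideanSpace ℝ (Fin p)}
    (hrun : ∀ ω, IsRun X (response X ξ β ω) s (fun t => b t ω)) (hss : sstar ≤ s) (hRpos : 0 < R)
    (hR₀ : σ * √((sstar : ℝ) / n) ≤ R)
    (hτ : σ * √(2 * Real.log (p / sstar) / n) * √((s : ℝ) - sstar) ≤ 2 * R)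
    (hinit : (1 / 2) ^ t * (C₁ * σ * √(sstar * Real.log (p / sstar) / n)) ≤ R) :
    P {ω | IsMinimaxInit C₁ σ n sstar s β (b 0 ω) ∧
        (2 + 4 * ((7 + 2 / ε) * 4 + 2 * √(64 * (1 + 1 / ε)) + 4)) * R ≤ ‖b t ω - β‖} ≤
      ENNReal.ofReal (Real.exp (-1 * sstar) + ((sstar : ℝ) / p) ^ ε) := by
  have hsp : sstar ≤ p := le_of_mem_signalClass hβ
  obtain ⟨hl0, hbmin⟩ := hβ
  have hcard : (supp β).card = sstar := hl0
  have hn' : (0 : ℝ) < n := by exact_mod_cast hn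
  set a := σ * √(2 * Real.log (p / sstar) / n) with ha
  have ha0 : 0 ≤ a := by positivity
  have hZtail := hξ.measure_partialNorm_ge_le hn hσ hR (V := supp β) (by omega)
  have hWtail := hξ.measure_partialNorm_trunc_ge_le hn hσ hX hε0 hε1 hs1 hsp (supp β)ᶜ
  rw [hcard] at hZtail
  rw [← ha] at hWtail
  have key : ∀ {x K : ℝ}, 0 ≤ K → ¬ (K ^ 2 * (σ ^ 2 * sstar / n) ≤ x ^ 2) → x ≤ K * R := by
    intro x K hK hx
    have h1 : K ^ 2 * (σ ^ 2 * sstar / n) = (K * (σ * √((sstar : ℝ) / n))) ^ 2 := by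
      rw [mul_pow, mul_pow, Real.sq_sqrt (by positivity)]; ring
    rw [h1, not_le] at hx
    have h2 := abs_lt_of_sq_lt_sq hx (by positivity)
    exact ((le_abs_self x).trans h2.le).trans (by gcongr)
  refine (measure_mono (t := {ω | 16 * (σ ^ 2 * sstar / n) ≤
      partialNorm (supp β) (fun i => scaledNoise X (noise ξ ω) i) ^ 2} ∪
      {ω | 64 * (1 + 1 / ε) * (σ ^ 2 * sstar / n) ≤ partialNorm (supp β)ᶜ
        (fun i => trunc ((1 + ε) * a) (scaledNoise X (noise ξ ω) i)) ^ 2}) ?_).trans ?_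
  · rintro ω ⟨⟨h0, h0s⟩, hlarge⟩
    by_contra hgood
    simp only [Set.mem_union, Set.mem_ofPred_eq, not_or] at hgood
    obtain ⟨hg1, hg2⟩ := hgood
    have hZ := key (K := 4) (by norm_num) (by norm_num; simpa using hg1)
    have hW : partialNorm (supp β)ᶜ (fun i => trunc ((1 + ε) * a) (scaledNoise X (noise ξ ω) i)) ≤
        √(64 * (1 + 1 / ε)) * R := key (Real.sqrt_nonneg _)
      (by rw [Real.sq_sqrt (by positivity)]; exact hg2)
    have hbd := IsRun.error_le hn hε0 hε1 hR hδ (hl0.le.trans hss) h0s ha0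
      (fun i hi => by rw [ha, ← mul_assoc]; exact hlam.trans (hbmin i hi)) (hrun ω) hZ hW
      (by rw [hl0]; exact hτ) t
    have h1 : (1 / 2) ^ t * ‖b 0 ω - β‖ ≤ R :=
      (mul_le_mul_of_nonneg_left h0 (by positivity)).trans hinit
    linarith
  · refine (measure_union_le _ _).trans ?_
    rw [ENNReal.ofReal_add (Real.exp_pos _).le (by positivity), neg_one_mul]
    exact add_le_add hZtail hWtail

/-- After squaring, `t` halvings gain `4 ^ t ≥ exp t`, so the natural logarithm in the iteration
count suffices. -/
lemma half_pow_mul_sqrt_le {C σ x y : ℝ} {t : ℕ} (hσ : 0 < σ) (hC : 0 < C)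
    (h : C ^ 2 * x ≤ Real.exp t * y) (hy : 0 ≤ y) :
    (1 / 2) ^ t * (C * σ * √x) ≤ σ * √y := by
  have h4 : Real.exp t ≤ (2 ^ t) ^ 2 := by
    rw [← pow_mul, mul_comm t 2, pow_mul, ← mul_one (t : ℝ), Real.exp_nat_mul]
    have := Real.exp_one_lt_d9
    exact pow_le_pow_left₀ (Real.exp_pos _).le (by linarith) _
  have h5 : C * √x ≤ 2 ^ t * √y := by
    rw [← Real.sqrt_sq hC.le, ← Real.sqrt_mul (sq_nonneg C),
      ← Real.sqrt_sq (by positivity : (0 : ℝ) ≤ 2 ^ t), ← Real.sqrt_mul (sq_nonneg _)]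
    exact Real.sqrt_le_sqrt (h.trans (mul_le_mul_of_nonneg_right h4 hy))
  calc (1 / 2) ^ t * (C * σ * √x) = σ * ((1 / 2) ^ t * (C * √x)) := by ring
    _ ≤ σ * ((1 / 2) ^ t * (2 ^ t * √y)) := by gcongr
    _ = σ * √y := by rw [← mul_assoc ((1 / 2 : ℝ) ^ t), ← mul_pow]; norm_num

lemma sqrt_mul_sqrt_le {σ x y w : ℝ} (hσ : 0 < σ) (hx : 0 ≤ x) (h : x * y ≤ 4 * w) :
    σ * √x * √y ≤ 2 * (σ * √w) := by
  have h1 : √x * √y ≤ 2 * √w := by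
    rw [← Real.sqrt_mul hx, show (2 : ℝ) = √(2 ^ 2) by rw [Real.sqrt_sq (by norm_num)],
      ← Real.sqrt_mul (by norm_num)]
    exact Real.sqrt_le_sqrt (by linarith)
  nlinarith

lemma le_exp_mul_of_log_le {x y : ℝ} {t : ℕ} (hx : 0 < x) (hy : 0 ≤ y) (h : Real.log x ≤ t) :
    x * y ≤ Real.exp t * y :=
  mul_le_mul_of_nonneg_right ((Real.log_le_iff_le_exp hx).1 h) hy

end HTP

end

theorem theorem3 (ε : ℝ) (hε0 : 0 < ε) (hε1 : ε < 1) :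
    ∃ C₂ C₃ C₄ : ℝ, 0 < C₂ ∧ 0 < C₃ ∧ 0 < C₄ ∧
    ∀ C₁ : ℝ, 0 < C₁ → ∃ C₁ε : ℝ, 0 < C₁ε ∧
    ∀ (n p sstar s : ℕ) (σ lam δ : ℝ) (X : Matrix (Fin n) (Fin p) ℝ),
      0 < n → 1 ≤ sstar → 0 < σ →
      (∀ j, ∑ i, X i j ^ 2 = (n : ℝ)) →
      HTP.RIP X (3 * s) δ → δ < min (ε ^ 2) 0.005 →
      (1 + 3 * ε) * σ * √(2 * Real.log (p / sstar) / n) ≤ lam →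
    ∀ (Ω : Type*) [MeasurableSpace Ω] (P : Measure Ω) [IsProbabilityMeasure P]
      (ξ : Fin n → Ω → ℝ), HTP.IsSubGaussianNoise P ξ σ →
    -- for each signal `β`, a random initial value `b β 0` and the iterates `b β t` started there
    ∀ (b : EuclideanSpace ℝ (Fin p) → ℕ → Ω → EuclideanSpace ℝ (Fin p)),
      (∀ β ∈ HTP.signalClass p sstar lam, ∀ ω,
        HTP.IsRun X (HTP.response X ξ β ω) s (fun t => b β t ω)) →
      (sstar ≤ s → (s : ℝ) ≤ sstar + sstar / Real.log (p / sstar) →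
        ∀ t : ℕ, Real.log (C₁ε ^ 2 * Real.log (p / sstar)) ≤ t →
          (⨆ β ∈ HTP.signalClass p sstar lam,
            P {ω | HTP.IsMinimaxInit C₁ σ n sstar s β (b β 0 ω) ∧
              C₂ * σ * √((sstar : ℝ) / n) ≤ ‖b β t ω - β‖})
          ≤ ENNReal.ofReal (Real.exp (-C₃ * sstar) + ((sstar : ℝ) / p) ^ C₄)) ∧
      (∀ τ : ℕ, s = sstar + τ → (sstar : ℝ) / Real.log (p / sstar) < τ → τ ≤ 3 * sstar →
        ∀ t : ℕ, Real.log (C₁ ^ 2 * sstar / τ) ≤ t →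
          (⨆ β ∈ HTP.signalClass p sstar lam,
            P {ω | HTP.IsMinimaxInit C₁ σ n sstar s β (b β 0 ω) ∧
              C₂ * σ * √(τ * Real.log (p / sstar) / n) ≤ ‖b β t ω - β‖})
          ≤ ENNReal.ofReal (Real.exp (-C₃ * sstar) + ((sstar : ℝ) / p) ^ C₄)) := by
  -- The `4 * (...)` is the accumulated noise in units of the target rate `R`. Of the leading 2, one
  -- unit pays for the initial error and the other makes the contradiction strict. The probabilities
  -- carry the exponents `1` and `ε`.
  refine ⟨2 + 4 * ((7 + 2 / ε) * 4 + 2 * √(64 * (1 + 1 / ε)) + 4), 1, ε, by positivity, one_pos,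
    hε0, fun C₁ hC₁ => ⟨C₁, hC₁, ?_⟩⟩
  intro n p sstar s σ lam δ X hn hs1 hσ hX hR hδ hlam Ω _ P _ ξ hξ b hrun
  have hn' : (0 : ℝ) < n := by exact_mod_cast hn
  have hs' : (0 : ℝ) < sstar := by exact_mod_cast hs1
  -- A nonpositive logarithm forces `s* = p` on a nonempty class, and the claimed bound then exceeds
  -- 1.
  have htriv : ∀ β ∈ HTP.signalClass p sstar lam, Real.log (p / sstar) ≤ 0 → ∀ E : Set Ω,
      P E ≤ ENNReal.ofReal (Real.exp (-1 * sstar) + ((sstar : ℝ) / p) ^ ε) := by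
    intro β hβ hL E
    have hsp : (sstar : ℝ) ≤ p := by exact_mod_cast HTP.le_of_mem_signalClass hβ
    have hps : (p : ℝ) ≤ sstar := by
      have h1 := (Real.log_nonpos_iff (div_nonneg (Nat.cast_nonneg p) hs'.le)).1 hL
      rwa [div_le_one hs'] at h1
    rw [hsp.antisymm hps, div_self (hs'.trans_le hsp).ne', Real.one_rpow]
    refine prob_le_one.trans ?_
    rw [← ENNReal.ofReal_one]
    exact ENNReal.ofReal_le_ofReal (le_add_of_nonneg_left (Real.exp_pos _).le)
  refine ⟨fun hss hs t ht => iSup₂_le fun β hβ => ?_, fun τ hsτ hτ _ t ht => iSup₂_le fun β hβ => ?_⟩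
  · rcases le_or_gt (Real.log (p / sstar)) 0 with hL | hL
    · exact htriv β hβ hL _
    set L := Real.log (p / sstar)
    rw [mul_assoc _ σ]
    -- Here `R = σ(s*/n)^{1/2}`; the restriction on `s` gives `(s - s*)L ≤ s*`, so the surplus slots
    -- stay within this rate.
    refine HTP.measure_error_ge_le hε0 hε1 hn hs1 hσ hX hR hδ hlam hξ hβ (hrun β hβ) hss
      (by positivity) le_rfl ?_ ?_
    · refine HTP.sqrt_mul_sqrt_le hσ (by positivity) ?_
      have h1 : ((s : ℝ) - sstar) * L ≤ sstar := by
        rw [← le_div_iff₀ hL]; linarith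
      have h2 : 2 * L / n * ((s : ℝ) - sstar) = 2 * (((s : ℝ) - sstar) * L) / n := by ring
      rw [h2, ← mul_div_assoc]
      exact div_le_div_of_nonneg_right (by linarith) hn'.le
    · refine HTP.half_pow_mul_sqrt_le hσ hC₁ ?_ (by positivity)
      have h := HTP.le_exp_mul_of_log_le (y := (sstar : ℝ) / n) (by positivity) (by positivity) ht
      refine le_trans (le_of_eq ?_) h
      ring
  · rcases le_or_gt (Real.log (p / sstar)) 0 with hL | hL
    · exact htriv β hβ hL _
    set L := Real.log (p / sstar)
    have hτ0 : (0 : ℝ) < τ := (div_pos hs' hL).trans hτ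
    rw [mul_assoc _ σ]
    -- Here `R = σ(τL/n)^{1/2}`, which dominates `σ(s*/n)^{1/2}` because `τL > s*`.
    refine HTP.measure_error_ge_le hε0 hε1 hn hs1 hσ hX hR hδ hlam hξ hβ (hrun β hβ) (by omega)
      (by positivity) ?_ ?_ ?_
    · gcongr
      exact ((div_lt_iff₀ hL).1 hτ).le
    · refine HTP.sqrt_mul_sqrt_le hσ (by positivity) ?_
      have h2 : 2 * L / n * ((s : ℝ) - sstar) = 2 * (τ * L / n) := by
        rw [hsτ]; push_cast; ring
      rw [h2]
      have : 0 ≤ τ * L / n := by positivity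
      linarith
    · refine HTP.half_pow_mul_sqrt_le hσ hC₁ ?_ (by positivity)
      have h := HTP.le_exp_mul_of_log_le (y := τ * L / n) (by positivity) (by positivity) ht
      refine le_trans (le_of_eq ?_) h
      rw [div_mul_eq_mul_div, eq_div_iff hτ0.ne']
      ring
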